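/- **Definitions.** A *de Vries algebra* is a pair $\mathfrak A=(A,\prec)$ where $A$ is a complete Boolean algebra and $\prec$ is a binary relation on $A$ such that: $1\prec 1$; $a\prec b$ implies $a\le b$; $a\le b\prec c\le d$ implies $a\prec d$; $a\prec b$ and $a\prec c$ imply $a\prec b\wedge c$; $a\prec b$ implies $\neg b\prec\neg a$; $a\prec b$ implies $a\prec c\prec b$ for some $c$; and every $b\neq 0$ admits $a\neq 0$ with $a\prec b$. A *de Vries morphism* $\rho:\mathfrak A\to\mathfrak B$ is a map with $\rho(0)=0$, $\rho(a\wedge b)=\rho(a)\wedge\rho(b)$, $\rho(b)=\bigvee\{\rho(a)\mid a\prec b\}$, and such that $a\prec b$ implies $\neg\rho(\neg a)\prec\rho(b)$. De Vries morphisms are composed by $(\rho_2\star\rho_1)(b)=\bigvee\{\rho_2(\rho_1(a))\mid a\prec b\}$. A *de Vries extension* is an injective de Vries morphism $\alpha:\mathfrak A\to\mathfrak B$ where $B$ is an atomic complete Boolean algebra, the proximity of $\mathfrak B$ is $\le$, and each element of $B$ is a join of meets of elements of $\alpha[A]$. The category $\mathsf{DeVe}$ has the de Vries extensions as objects; a morphism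 from $\alpha:\mathfrak A\to\mathfrak B$ to $\alpha':\mathfrak A'\to\mathfrak B'$ is a pair $(\rho,\sigma)$ with $\rho:\mathfrak A\to\mathfrak A'$ a de Vries morphism, $\sigma:B\to B'$ a complete Boolean homomorphism, and $\sigma\circ\alpha=\alpha'\star\rho$; composition is $(\rho_2,\sigma_2)(\rho_1,\sigma_1)=(\rho_2\star\rho_1,\sigma_2\circ\sigma_1)$. A de Vries extension $\alpha:\mathfrak A\to\mathfrak B$ is *maximal* if for every de Vries extension $\gamma:\mathfrak C\to\mathfrak B$ with $\gamma[C]=\alpha[A]$ there is a de Vries morphism $\delta:\mathfrak C\to\mathfrak A$ with $\alpha\star\delta=\gamma$. Let $\mathsf{MDeVe}$ be the full subcategory of $\mathsf{DeVe}$ of maximal de Vries extensions. The category $\mathsf C$ has as objects the compactifications $e:X\to Y$ (topological embeddings with dense image of a completely regular Hausdorff space $X$ in a compact Hausdorff space $Y$); a morphism from $e:X\to Y$ to $e':X'\to Y'$ is a pair of continuous maps $f:X\to X'$, $g:Y\to Y'$ with $g\circ e=e'\circ f$, composed componentwise. Let $\mathsf{SC}$ be the full subcategory of $\mathsf C$ of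 Stone–Čech compactifications, i.e. of those $e:X\to Y$ that are equivalent to $s:X\to\beta X$: there are continuous maps $\beta X\to Y$ and $Y\to\beta X$ commuting with $e$ and $s$. **Theorem 6.5.** There is a dual equivalence between $\mathsf{MDeVe}$ and $\mathsf{SC}$, i.e. the categories $\mathsf{MDeVe}^{\mathrm{op}}$ and $\mathsf{SC}$ are equivalent. -/

import Mathlib

open CategoryTheory

universe u

namespace DeVries

/-! ### De Vries algebras and de Vries morphisms -/

/-- A de Vries proximity `≺` on a Boolean algebra. -/
structure Proximity (A : Type u) [BooleanAlgebra A] where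
  /-- the relation `a ≺ b` -/
  rel : A → A → Prop
  top_rel_top : rel ⊤ ⊤
  le_of_rel : ∀ {a b : A}, rel a b → a ≤ b
  mono : ∀ {a b c d : A}, a ≤ b → rel b c → c ≤ d → rel a d
  rel_inf : ∀ {a b c : A}, rel a b → rel a c → rel a (b ⊓ c)
  rel_compl : ∀ {a b : A}, rel a b → rel bᶜ aᶜ
  interpolate : ∀ {a b : A}, rel a b → ∃ c, rel a c ∧ rel c b
  exists_ne_bot : ∀ {b : A}, b ≠ ⊥ → ∃ a, a ≠ ⊥ ∧ rel a b

/-- A de Vries algebra: a complete Boolean algebra with a de Vries proximity. -/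
structure DeVAlg : Type (u + 1) where
  carrier : Type u
  [cba : CompleteBooleanAlgebra carrier]
  prox : Proximity carrier

attribute [instance] DeVAlg.cba

instance : CoeSort DeVAlg.{u} (Type u) := ⟨DeVAlg.carrier⟩

/-- The proximity of a de Vries algebra. -/
def DeVAlg.prec (A : DeVAlg.{u}) (a b : A) : Prop := A.prox.rel a b

/-- A de Vries morphism. -/
@[ext]
structure DeVMor (A B : DeVAlg.{u}) where
  toFun : A → B
  map_bot : toFun ⊥ = ⊥
  map_inf : ∀ a b : A, toFun (a ⊓ b) = toFun a ⊓ toFun b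
  map_prec : ∀ a b : A, A.prec a b → B.prec (toFun aᶜ)ᶜ (toFun b)
  map_eq_sSup : ∀ b : A, toFun b = sSup (toFun '' {a | A.prec a b})

namespace DeVMor

instance {A B : DeVAlg.{u}} : CoeFun (DeVMor A B) (fun _ => A → B) := ⟨DeVMor.toFun⟩

variable {A B C D : DeVAlg.{u}}

theorem monotone (ρ : DeVMor A B) : Monotone ρ.toFun := by
  intro a b h
  have := ρ.map_inf a b
  rw [inf_eq_left.mpr h] at this
  rw [this]
  exact inf_le_right

theorem le_compl_map_compl (ρ : DeVMor A B) (a : A) : ρ a ≤ (ρ aᶜ)ᶜ := by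
  rw [le_compl_iff_disjoint_right, disjoint_iff, ← ρ.map_inf, inf_compl_self, ρ.map_bot]

theorem prec_of_prec (ρ : DeVMor A B) {a b : A} (h : A.prec a b) : B.prec (ρ a) (ρ b) :=
  B.prox.mono (ρ.le_compl_map_compl a) (ρ.map_prec a b h) le_rfl

theorem inf_prec_inf {a b c d : A} (h : A.prec a c) (h' : A.prec b d) :
    A.prec (a ⊓ b) (c ⊓ d) :=
  A.prox.rel_inf (A.prox.mono inf_le_left h le_rfl) (A.prox.mono inf_le_right h' le_rfl)

/-- The identity de Vries morphism. -/
def id (A : DeVAlg.{u}) : DeVMor A A where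
  toFun a := a
  map_bot := rfl
  map_inf _ _ := rfl
  map_prec a b h := by rw [compl_compl]; exact h
  map_eq_sSup b := by
    apply le_antisymm
    · by_contra hn
      have hne : b ⊓ (sSup ((fun a => a) '' {a | A.prec a b}))ᶜ ≠ ⊥ := by
        intro h
        exact hn (by rwa [← sdiff_eq, sdiff_eq_bot_iff] at h)
      obtain ⟨a, ha, hab⟩ := A.prox.exists_ne_bot hne
      have h1 : a ≤ sSup ((fun a => a) '' {a | A.prec a b}) :=
        le_sSup ⟨a, A.prox.mono le_rfl hab inf_le_left, rfl⟩
      have h2 := (A.prox.le_of_rel hab).trans inf_le_right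
      exact ha (le_bot_iff.mp ((le_inf h1 h2).trans_eq (inf_compl_self _)))
    · apply sSup_le
      rintro _ ⟨a, ha, rfl⟩
      exact A.prox.le_of_rel ha

/-- The composition `ρ₂ ⋆ ρ₁` of de Vries morphisms:
`(ρ₂ ⋆ ρ₁) b = ⋁ {ρ₂ (ρ₁ a) | a ≺ b}`. -/
def star (ρ₂ : DeVMor B C) (ρ₁ : DeVMor A B) : DeVMor A C where
  toFun b := sSup ((fun a => ρ₂ (ρ₁ a)) '' {a | A.prec a b})
  map_bot := by
    rw [eq_bot_iff]
    apply sSup_le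
    rintro _ ⟨a, ha, rfl⟩
    have : a = ⊥ := le_bot_iff.mp (A.prox.le_of_rel ha)
    simp only [this, ρ₁.map_bot, ρ₂.map_bot, le_refl]
  map_inf a b := by
    apply le_antisymm
    · apply sSup_le
      rintro _ ⟨x, hx, rfl⟩
      exact le_inf (le_sSup ⟨x, A.prox.mono le_rfl hx inf_le_left, rfl⟩)
        (le_sSup ⟨x, A.prox.mono le_rfl hx inf_le_right, rfl⟩)
    · rw [sSup_inf_sSup]
      apply iSup₂_le
      rintro ⟨_, _⟩ ⟨⟨x, hx, rfl⟩, ⟨y, hy, rfl⟩⟩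
      refine le_sSup ⟨x ⊓ y, inf_prec_inf hx hy, ?_⟩
      simp only [ρ₁.map_inf, ρ₂.map_inf]
  map_prec a b h := by
    obtain ⟨c, hac, hcb⟩ := A.prox.interpolate h
    obtain ⟨d, hcd, hdb⟩ := A.prox.interpolate hcb
    have h2 := ρ₂.map_prec _ _ (ρ₁.map_prec c d hcd)
    rw [compl_compl] at h2
    exact C.prox.mono (compl_le_compl (le_sSup ⟨cᶜ, A.prox.rel_compl hac, rfl⟩)) h2
      (le_sSup ⟨d, hdb, rfl⟩)
  map_eq_sSup b := by
    apply le_antisymm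
    · apply sSup_le
      rintro _ ⟨a, ha, rfl⟩
      obtain ⟨c, hac, hcb⟩ := A.prox.interpolate ha
      have h1 : ρ₂ (ρ₁ a) ≤ sSup ((fun x => ρ₂ (ρ₁ x)) '' {x | A.prec x c}) :=
        le_sSup ⟨a, hac, rfl⟩
      exact h1.trans (le_sSup ⟨c, hcb, rfl⟩)
    · apply sSup_le
      rintro _ ⟨c, hc, rfl⟩
      apply sSup_le
      rintro _ ⟨a, ha, rfl⟩
      exact le_sSup ⟨a, A.prox.mono le_rfl ha (A.prox.le_of_rel hc), rfl⟩

theorem star_id (ρ : DeVMor A B) : ρ.star (id A) = ρ := by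
  ext b
  exact (ρ.map_eq_sSup b).symm

theorem star_le (ρ₂ : DeVMor B C) (ρ₁ : DeVMor A B) (b : A) : ρ₂.star ρ₁ b ≤ ρ₂ (ρ₁ b) := by
  apply sSup_le
  rintro _ ⟨a, ha, rfl⟩
  exact ρ₂.monotone (ρ₁.monotone (A.prox.le_of_rel ha))

theorem le_star (ρ₂ : DeVMor B C) (ρ₁ : DeVMor A B) {a b : A} (h : A.prec a b) :
    ρ₂ (ρ₁ a) ≤ ρ₂.star ρ₁ b :=
  le_sSup ⟨a, h, rfl⟩

theorem id_star (ρ : DeVMor A B) : (id B).star ρ = ρ := by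
  ext b
  exact (ρ.map_eq_sSup b).symm

theorem star_assoc (ρ₃ : DeVMor C D) (ρ₂ : DeVMor B C) (ρ₁ : DeVMor A B) :
    (ρ₃.star ρ₂).star ρ₁ = ρ₃.star (ρ₂.star ρ₁) := by
  ext b
  apply le_antisymm
  · apply sSup_le
    rintro _ ⟨a, ha, rfl⟩
    obtain ⟨c, hac, hcb⟩ := A.prox.interpolate ha
    exact (star_le _ _ _).trans ((ρ₃.monotone (le_star ρ₂ ρ₁ hac)).trans (le_star ρ₃ _ hcb))
  · apply sSup_le
    rintro _ ⟨a, ha, rfl⟩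
    obtain ⟨c, hac, hcb⟩ := A.prox.interpolate ha
    exact (ρ₃.monotone (star_le ρ₂ ρ₁ a)).trans
      ((le_star ρ₃ ρ₂ (ρ₁.prec_of_prec hac)).trans (le_star (ρ₃.star ρ₂) ρ₁ hcb))

end DeVMor

/-- The category of de Vries algebras and de Vries morphisms, with composition `⋆`. -/
instance : Category DeVAlg.{u} where
  Hom := DeVMor
  id := DeVMor.id
  comp f g := g.star f
  id_comp := DeVMor.star_id
  comp_id := DeVMor.id_star
  assoc f g h := (DeVMor.star_assoc h g f).symm

/-! ### De Vries extensions -/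

/-- An atomic extremally disconnected de Vries algebra: the underlying Boolean algebra is
atomic and the proximity is the order. -/
structure DeVAlg.IsAtomicED (B : DeVAlg.{u}) : Prop where
  isAtomic : IsAtomic B
  prec_iff_le : ∀ a b : B, B.prec a b ↔ a ≤ b

/-- Each element of `B` is a join of meets of elements of the image of `α`. -/
def JoinMeetDense {A B : DeVAlg.{u}} (α : DeVMor A B) : Prop :=
  ∀ b : B, ∃ 𝒮 : Set (Set B), (∀ S ∈ 𝒮, S ⊆ Set.range α.toFun) ∧ b = sSup (sInf '' 𝒮)

/-- A de Vries morphism that is a de Vries extension. -/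
structure IsExtension {A B : DeVAlg.{u}} (α : DeVMor A B) : Prop where
  isAtomicED : B.IsAtomicED
  injective : Function.Injective α.toFun
  joinMeetDense : JoinMeetDense α

/-- A de Vries extension `α : A → B`. -/
structure DeVExt : Type (u + 1) where
  A : DeVAlg.{u}
  B : DeVAlg.{u}
  α : DeVMor A B
  isExtension : IsExtension α

/-- A morphism `(ρ, σ)` of de Vries extensions: `ρ` is a de Vries morphism, `σ` a complete
Boolean homomorphism, and `σ ∘ α = α' ⋆ ρ`. -/
@[ext]
structure DeVExtHom (E E' : DeVExt.{u}) where
  ρ : DeVMor E.A E'.A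
  σ : CompleteLatticeHom E.B E'.B
  comm : ∀ a : E.A, σ (E.α a) = E'.α.star ρ a

theorem DeVExtHom.comp_comm {E₁ E₂ E₃ : DeVExt.{u}} (f : DeVExtHom E₁ E₂)
    (g : DeVExtHom E₂ E₃) (a : E₁.A) :
    (g.σ.comp f.σ) (E₁.α a) = E₃.α.star (g.ρ.star f.ρ) a := by
  rw [← DeVMor.star_assoc]
  change g.σ (f.σ (E₁.α a)) = sSup ((fun x => E₃.α.star g.ρ (f.ρ x)) '' {x | E₁.A.prec x a})
  rw [f.comm]
  change g.σ (sSup ((fun x => E₂.α (f.ρ x)) '' {x | E₁.A.prec x a})) = _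
  rw [map_sSup, Set.image_image]
  simp only [g.comm]

/-- The category of de Vries extensions. -/
instance : Category DeVExt.{u} where
  Hom := DeVExtHom
  id E := ⟨DeVMor.id E.A, CompleteLatticeHom.id E.B, fun a => by
    rw [DeVMor.star_id]; rfl⟩
  comp f g := ⟨g.ρ.star f.ρ, g.σ.comp f.σ, DeVExtHom.comp_comm f g⟩
  id_comp f := DeVExtHom.ext (DeVMor.star_id _) rfl
  comp_id f := DeVExtHom.ext (DeVMor.id_star _) rfl
  assoc f g h := DeVExtHom.ext (DeVMor.star_assoc _ _ _).symm rfl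

/-- Two morphisms into the same de Vries algebra are compatible if they have the same image. -/
def Compatible {A B C : DeVAlg.{u}} (α : DeVMor A B) (γ : DeVMor C B) : Prop :=
  Set.range α.toFun = Set.range γ.toFun

/-- The de Vries extension `E` is maximal: every de Vries extension `γ : C → B` compatible with
`α : A → B` factors as `γ = α ⋆ δ` for some de Vries morphism `δ : C → A`. -/
def IsMaximal : ObjectProperty DeVExt.{u} := fun E =>
  ∀ (C : DeVAlg.{u}) (γ : DeVMor C E.B), IsExtension γ → Compatible E.α γ →
    ∃ δ : DeVMor C E.A, E.α.star δ = γ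

/-- The full subcategory of maximal de Vries extensions. -/
abbrev MDeVe : Type (u + 1) := IsMaximal.{u}.FullSubcategory

/-! ### Compactifications -/

/-- A compactification `e : X → Y` of a completely regular (Hausdorff) space `X`. -/
structure Compactification : Type (u + 1) where
  X : Type u
  Y : Type u
  [topX : TopologicalSpace X]
  [t35X : T35Space X]
  [topY : TopologicalSpace Y]
  [compactY : CompactSpace Y]
  [t2Y : T2Space Y]
  e : X → Y
  isEmbedding : Topology.IsEmbedding e
  denseRange : DenseRange e

attribute [instance] Compactification.topX Compactification.t35X Compactification.topY
  Compactification.compactY Compactification.t2Y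

/-- A morphism of compactifications: a pair of continuous maps making the square commute. -/
@[ext]
structure CompactificationHom (c c' : Compactification.{u}) where
  f : C(c.X, c'.X)
  g : C(c.Y, c'.Y)
  comm : ∀ x : c.X, g (c.e x) = c'.e (f x)

/-- The category of compactifications, with varying base spaces. -/
instance : Category Compactification.{u} where
  Hom := CompactificationHom
  id c := ⟨ContinuousMap.id _, ContinuousMap.id _, fun _ => rfl⟩
  comp p q := ⟨q.f.comp p.f, q.g.comp p.g, fun x => by
    simp only [ContinuousMap.comp_apply, p.comm, q.comm]⟩

/-- For two compactifications of the same space: `e ≤ e'` if `f ∘ e' = e` for some continuous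
`f : Y' → Y`. -/
def CompactificationLE {X Y Y' : Type u} [TopologicalSpace Y] [TopologicalSpace Y']
    (e : X → Y) (e' : X → Y') : Prop :=
  ∃ f : Y' → Y, Continuous f ∧ f ∘ e' = e

/-- The compactification `e : X → Y` is (equivalent to) the Stone-Čech compactification
`X → βX` of `X`. -/
def IsStoneCech : ObjectProperty Compactification.{u} := fun c =>
  CompactificationLE c.e (stoneCechUnit : c.X → StoneCech c.X) ∧
    CompactificationLE (stoneCechUnit : c.X → StoneCech c.X) c.e

/-- The full subcategory of Stone-Čech compactifications. -/
abbrev SC : Type (u + 1) := IsStoneCech.{u}.FullSubcategory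

end DeVries

namespace DeVries

open TopologicalSpace Heyting

/-! ### Morphisms into algebras whose proximity is the order -/

section Extension

variable {A B C : DeVAlg.{u}}

/-! A compactification `e : X → Y` gives the extension `U ↦ e⁻¹(U)` from the regular open sets of
`Y`, with proximity `cl U ⊆ V`, to the power set of `X`. Conversely, once the codomain of an
extension is represented as the power set of its atoms, the image is a basis of a completely regular
Hausdorff topology and consists of exactly its regular open sets (`DeVMor.range_eq_regularOpen`). So
extensions with the same image have isomorphic Boolean algebras and can differ only in their
proximities.

Interpolation turns `a ≺ b` into a continuous function separating the image of `a` from the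
complement of the image of `b` (`DeVMor.exists_continuous_separating`). A Stone–Čech
compactification extends this function, so its proximity contains every competing one: its extension
is maximal (`IsStoneCech.isMaximal`). Two maximal extensions with the same image factor through each
other, so every maximal extension comes from the Stone–Čech compactification of its space of atoms
(`IsMaximal.nonempty_iso`).

The functor is full because a complete homomorphism of power sets is a preimage map, whose
underlying function is continuous and extends to the compactifications. Both kinds of morphism are
determined by one component (`DeVExtHom.ext_of_σ`, `CompactificationHom.ext_of_f`), so the other
never has to be compared. -/

theorem DeVMor.map_top (ρ : DeVMor A B) : ρ ⊤ = ⊤ := by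
  have h := B.prox.le_of_rel (ρ.map_prec ⊤ ⊤ A.prox.top_rel_top)
  rw [compl_top, ρ.map_bot, compl_bot] at h
  exact top_le_iff.mp h

theorem DeVMor.le_iff_le (α : DeVMor A B) (h : Function.Injective α.toFun) {a b : A} :
    α a ≤ α b ↔ a ≤ b := by
  refine ⟨fun hab => inf_eq_left.mp (h ?_), fun hab => α.monotone hab⟩
  rw [α.map_inf]
  exact inf_eq_left.mpr hab

/-- An injective de Vries morphism is a monomorphism. -/
theorem DeVMor.star_left_cancel (α : DeVMor B C) (h : Function.Injective α.toFun)
    {μ ν : DeVMor A B} (e : α.star μ = α.star ν) : μ = ν := by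
  have key : ∀ {μ ν : DeVMor A B}, α.star μ = α.star ν → ∀ b, μ b ≤ ν b := by
    intro μ ν e b
    -- For `c ≺ b`, `α (μ c) ≤ (α ⋆ μ) b = (α ⋆ ν) b ≤ α (ν b)`, and an injective `α` reflects the
    -- order.
    rw [μ.map_eq_sSup b]
    apply sSup_le
    rintro _ ⟨c, hc, rfl⟩
    rw [← α.le_iff_le h]
    refine (α.le_star μ hc).trans ?_
    rw [e]
    exact α.star_le ν b
  ext b
  exact le_antisymm (key e b) (key e.symm b)

/-- A morphism of de Vries extensions is determined by its complete Boolean homomorphism. -/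
theorem DeVExtHom.ext_of_σ {E E' : DeVExt.{u}} {f g : DeVExtHom E E'} (h : f.σ = g.σ) : f = g := by
  refine DeVExtHom.ext (E'.α.star_left_cancel E'.isExtension.injective ?_) h
  ext a
  exact (f.comm a).symm.trans ((congrArg (fun σ => σ (E.α a)) h).trans (g.comm a))

/-- An order isomorphism that preserves the proximity is a de Vries morphism. -/
def DeVMor.ofOrderIso (θ : A ≃o B) (h : ∀ a b, A.prec a b → B.prec (θ a) (θ b)) :
    DeVMor A B where
  toFun := θ
  map_bot := θ.map_bot
  map_inf := θ.map_inf
  map_prec a b hab := by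
    have : (θ aᶜ)ᶜ = θ a := by rw [map_compl', compl_compl]
    rw [this]
    exact h a b hab
  map_eq_sSup b := by
    rw [sSup_image, ← θ.map_sSup]
    exact congrArg θ (((DeVMor.id A).map_eq_sSup b).trans (by simp [DeVMor.id]))

/-- Composition of a de Vries morphism with an order isomorphism between algebras
whose proximity is the order. -/
def DeVMor.postcomp (α : DeVMor A B) (hB : ∀ a b : B, B.prec a b ↔ a ≤ b)
    (hC : ∀ a b : C, C.prec a b ↔ a ≤ b) (θ : B ≃o C) : DeVMor A C where
  toFun a := θ (α a)
  map_bot := by rw [α.map_bot, θ.map_bot]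
  map_inf a b := by rw [α.map_inf, θ.map_inf]
  map_prec a b hab := by
    rw [hC, ← map_compl', θ.le_iff_le, ← hB]
    exact α.map_prec a b hab
  map_eq_sSup b := by
    rw [α.map_eq_sSup b, θ.map_sSup, sSup_image, iSup_image]

theorem IsExtension.postcomp {α : DeVMor A B} (hα : IsExtension α) (hC : C.IsAtomicED)
    (θ : B ≃o C) : IsExtension (α.postcomp hα.isAtomicED.prec_iff_le hC.prec_iff_le θ) where
  isAtomicED := hC
  injective := θ.injective.comp hα.injective
  joinMeetDense c := by
    obtain ⟨𝒮, h𝒮, hb⟩ := hα.joinMeetDense (θ.symm c)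
    refine ⟨(fun S => θ '' S) '' 𝒮, ?_, ?_⟩
    · rintro _ ⟨S, hS, rfl⟩ _ ⟨x, hx, rfl⟩
      obtain ⟨a, rfl⟩ := h𝒮 S hS hx
      exact ⟨a, rfl⟩
    · rw [← θ.apply_symm_apply c, hb, θ.map_sSup, sSup_image, iSup_image, iSup_image]
      simp only [θ.map_sInf, sInf_image]

end Extension

/-! ### The de Vries algebra of regular open sets -/

section RegularOpens

variable (Y : Type u) [TopologicalSpace Y]

/-- The regular open sets of a topological space. -/
abbrev RegOpens : Type u := Regular (Opens Y)

variable {Y}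

/-- The underlying set of a regular open set. -/
def RegOpens.set (U : RegOpens Y) : Set Y := (U.val : Set Y)

namespace RegOpens

theorem isOpen (U : RegOpens Y) : IsOpen U.set := U.val.isOpen

theorem set_injective : Function.Injective (RegOpens.set : RegOpens Y → Set Y) :=
  fun _ _ h => Regular.coe_injective (Opens.ext h)

theorem set_inf (U V : RegOpens Y) : (U ⊓ V).set = U.set ∩ V.set := rfl

theorem set_compl (U : RegOpens Y) : Uᶜ.set = (closure U.set)ᶜ := by
  rw [← interior_compl]
  exact Opens.coe_compl_eq_interior_compl

/-- The regularization `int cl W` of an open set `W`. -/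
def reg (W : Opens Y) : RegOpens Y := Regular.toRegular W

theorem set_reg (W : Opens Y) : (reg W).set = interior (closure (W : Set Y)) := by
  change ((Wᶜᶜ : Opens Y) : Set Y) = _
  rw [Opens.coe_compl_eq_interior_compl, Opens.coe_compl_eq_interior_compl,
    interior_compl (s := (W : Set Y)), compl_compl]

theorem interior_closure_set (U : RegOpens Y) : interior (closure U.set) = U.set := by
  have := set_reg U.val
  rw [show reg U.val = U from Regular.toRegular_coe U] at this
  exact this.symm

theorem subset_set_reg (W : Opens Y) : (W : Set Y) ⊆ (reg W).set :=
  le_compl_compl (a := W)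

theorem reg_le_iff {W : Opens Y} {U : RegOpens Y} : reg W ≤ U ↔ (W : Set Y) ⊆ U.set :=
  Regular.gi.gc W U

theorem reg_inf (V W : Opens Y) : reg (V ⊓ W) = reg V ⊓ reg W :=
  Regular.coe_injective (compl_compl_inf_distrib V W)

/-- Regularization is left adjoint to the inclusion into the open sets; this Galois insertion
supplies the arbitrary joins, which are regularized unions. -/
instance : CompleteBooleanAlgebra (RegOpens Y) :=
  { (inferInstance : BooleanAlgebra (Regular (Opens Y))),
    (Regular.gi (α := Opens Y)).liftCompleteLattice with }

/-- Every neighbourhood of a point in a regular space contains the closure of a regular open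
neighbourhood. -/
theorem exists_mem_closure_subset [RegularSpace Y] {y : Y} {W : Set Y} (hW : IsOpen W)
    (hy : y ∈ W) : ∃ U : RegOpens Y, y ∈ U.set ∧ closure U.set ⊆ W := by
  obtain ⟨K, hK, hKc, hKW⟩ := exists_mem_nhds_isClosed_subset (hW.mem_nhds hy)
  refine ⟨reg ⟨interior K, isOpen_interior⟩, subset_set_reg _ (mem_interior_iff_mem_nhds.mpr hK),
    ?_⟩
  rw [set_reg]
  refine (closure_minimal ?_ hKc).trans hKW
  exact interior_subset.trans (closure_minimal interior_subset hKc)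

/-- The proximity `cl U ⊆ V` on the regular open sets of a compact Hausdorff space. -/
def proximity [CompactSpace Y] [T2Space Y] : Proximity (RegOpens Y) where
  rel U V := closure U.set ⊆ V.set
  top_rel_top := Set.subset_univ _
  le_of_rel h := subset_closure.trans h
  mono h h' h'' := (closure_mono h).trans (h'.trans h'')
  rel_inf h h' := Set.subset_inter h h'
  rel_compl {U V} h := by
    rw [set_compl, set_compl]
    refine (closure_minimal (Set.compl_subset_compl.mpr subset_closure)
      V.isOpen.isClosed_compl).trans (Set.compl_subset_compl.mpr h)
  interpolate {U V} h := by
    obtain ⟨W, hW, hUW, hWV⟩ := normal_exists_closure_subset isClosed_closure V.isOpen h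
    refine ⟨reg ⟨W, hW⟩, hUW.trans (subset_set_reg ⟨W, hW⟩), ?_⟩
    rw [set_reg]
    exact (closure_minimal interior_subset isClosed_closure).trans hWV
  exists_ne_bot {U} hU := by
    obtain ⟨y, hy⟩ : U.set.Nonempty := by
      rw [Set.nonempty_iff_ne_empty]
      exact fun h => hU (set_injective h)
    obtain ⟨V, hyV, hVU⟩ := exists_mem_closure_subset U.isOpen hy
    refine ⟨V, ?_, hVU⟩
    rintro rfl
    exact hyV

end RegOpens

variable (Y) in
/-- The de Vries algebra of regular open sets of a compact Hausdorff space. -/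
def roAlg [CompactSpace Y] [T2Space Y] : DeVAlg.{u} where
  carrier := RegOpens Y
  prox := RegOpens.proximity

section Map

variable {Y Z : Type u} [TopologicalSpace Y] [TopologicalSpace Z]

namespace RegOpens

/-- The regular open set `int cl g⁻¹(U)`. -/
def comap (g : C(Y, Z)) (U : RegOpens Z) : RegOpens Y := reg (Opens.comap g U.val)

theorem preimage_subset_set_comap (g : C(Y, Z)) (U : RegOpens Z) :
    g ⁻¹' U.set ⊆ (comap g U).set :=
  subset_set_reg (Opens.comap g U.val)

theorem comap_le_iff {g : C(Y, Z)} {U : RegOpens Z} {V : RegOpens Y} :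
    comap g U ≤ V ↔ g ⁻¹' U.set ⊆ V.set :=
  reg_le_iff

/-- Regularizing may enlarge `g⁻¹(U)`, but not beyond the closed set `g⁻¹(cl U)`. -/
theorem set_comap_subset (g : C(Y, Z)) (U : RegOpens Z) :
    (comap g U).set ⊆ g ⁻¹' closure U.set := by
  refine (set_reg (Opens.comap g U.val)).subset.trans (interior_subset.trans ?_)
  exact closure_minimal (show g ⁻¹' U.set ⊆ _ from Set.preimage_mono subset_closure)
    (isClosed_closure.preimage g.continuous)

theorem comap_inf (g : C(Y, Z)) (U V : RegOpens Z) : comap g (U ⊓ V) = comap g U ⊓ comap g V :=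
  reg_inf (Opens.comap g U.val) (Opens.comap g V.val)

/-- This bounds the element `¬ρ(¬U)` in the proximity axiom for morphisms. -/
theorem closure_compl_comap_compl_subset (g : C(Y, Z)) (U : RegOpens Z) :
    closure ((comap g Uᶜ)ᶜ).set ⊆ g ⁻¹' closure U.set := by
  refine closure_minimal ?_ (isClosed_closure.preimage g.continuous)
  rw [set_compl, Set.compl_subset_comm]
  refine subset_trans ?_ (subset_closure.trans' (preimage_subset_set_comap g Uᶜ))
  rw [set_compl, Set.preimage_compl]

theorem comap_eq_sSup [RegularSpace Z] (g : C(Y, Z)) (U : RegOpens Z) :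
    comap g U = sSup (comap g '' {V | closure V.set ⊆ U.set}) := by
  apply le_antisymm
  · refine comap_le_iff.mpr fun y hy => ?_
    obtain ⟨V, hyV, hVU⟩ := exists_mem_closure_subset U.isOpen hy
    have hle : comap g V ≤ sSup (comap g '' {V | closure V.set ⊆ U.set}) :=
      le_sSup ⟨V, hVU, rfl⟩
    exact hle (preimage_subset_set_comap g V hyV)
  · apply sSup_le
    rintro _ ⟨V, hV, rfl⟩
    exact comap_le_iff.mpr ((Set.preimage_mono (subset_closure.trans hV)).trans
      (preimage_subset_set_comap g U))

end RegOpens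

/-- The de Vries morphism `U ↦ int cl g⁻¹(U)` of a continuous map. -/
def roMap [CompactSpace Y] [T2Space Y] [CompactSpace Z] [T2Space Z] (g : C(Y, Z)) :
    DeVMor (roAlg Z) (roAlg Y) where
  toFun := RegOpens.comap g
  map_bot := le_bot_iff.mp (RegOpens.comap_le_iff (V := ⊥) |>.mpr fun _ hy => hy)
  map_inf := RegOpens.comap_inf g
  map_prec U V h := (RegOpens.closure_compl_comap_compl_subset g U).trans
    ((Set.preimage_mono h).trans (RegOpens.preimage_subset_set_comap g V))
  map_eq_sSup := RegOpens.comap_eq_sSup g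

end Map

end RegularOpens

/-! ### Morphisms into power sets -/

section PowerSet

/-- The order of a complete Boolean algebra as a proximity. -/
def leProximity (B : Type u) [BooleanAlgebra B] : Proximity B where
  rel a b := a ≤ b
  top_rel_top := le_rfl
  le_of_rel h := h
  mono h h' h'' := h.trans (h'.trans h'')
  rel_inf h h' := le_inf h h'
  rel_compl h := compl_le_compl h
  interpolate h := ⟨_, h, le_rfl⟩
  exists_ne_bot h := ⟨_, h, le_rfl⟩

/-- The power set of `X` with the inclusion as proximity. -/
def powAlg (X : Type u) : DeVAlg.{u} where
  carrier := Set X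
  prox := leProximity (Set X)

theorem powAlg_isAtomicED (X : Type u) : (powAlg X).IsAtomicED where
  isAtomic := inferInstanceAs (IsAtomic (Set X))
  prec_iff_le _ _ := Iff.rfl

variable {X : Type u} {C : DeVAlg.{u}}

/-- A de Vries morphism into a power set, as a set-valued map. -/
def DeVMor.set (γ : DeVMor C (powAlg X)) (c : C) : Set X := γ c

namespace DeVMor

variable (γ : DeVMor C (powAlg X))

theorem set_mono {a b : C} (h : a ≤ b) : γ.set a ⊆ γ.set b := γ.monotone h

theorem set_inf (a b : C) : γ.set (a ⊓ b) = γ.set a ∩ γ.set b := γ.map_inf a b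

theorem set_bot : γ.set ⊥ = ∅ := γ.map_bot

theorem set_subset_compl (a : C) : γ.set a ⊆ (γ.set aᶜ)ᶜ := γ.le_compl_map_compl a

theorem compl_set_compl_subset {a b : C} (h : C.prec a b) : (γ.set aᶜ)ᶜ ⊆ γ.set b :=
  γ.map_prec a b h

theorem mem_set_iff {x : X} {b : C} : x ∈ γ.set b ↔ ∃ a, C.prec a b ∧ x ∈ γ.set a := by
  have h : γ.set b = sSup (γ.set '' {a | C.prec a b}) := γ.map_eq_sSup b
  rw [h, Set.sSup_eq_sUnion, Set.sUnion_image]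
  simp

theorem mem_star_set_iff {A : DeVAlg.{u}} (ρ : DeVMor A C) {x : X} {b : A} :
    x ∈ (γ.star ρ).set b ↔ ∃ a, A.prec a b ∧ x ∈ γ.set (ρ a) := by
  have h : (γ.star ρ).set b = sSup ((fun a => γ.set (ρ a)) '' {a | A.prec a b}) := rfl
  rw [h, Set.sSup_eq_sUnion, Set.sUnion_image]
  simp

variable {γ}

theorem disjoint_set_iff (hγ : Function.Injective γ.toFun) {a b : C} :
    Disjoint (γ.set a) (γ.set b) ↔ Disjoint a b := by
  rw [Set.disjoint_iff_inter_eq_empty, ← set_inf, ← set_bot γ, disjoint_iff]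
  exact hγ.eq_iff

variable [TopologicalSpace X]

/-- For `a ≺ b` the closed set `(γ.set aᶜ)ᶜ` lies between `γ.set a` and `γ.set b`, so `≺` implies
containment of closures. -/
theorem closure_set_subset (ho : ∀ c, IsOpen (γ.set c)) (a : C) :
    closure (γ.set a) ⊆ (γ.set aᶜ)ᶜ :=
  closure_minimal (γ.set_subset_compl a) (ho _).isClosed_compl

/-- The interpolation property turns the proximity into functional separation. -/
theorem exists_continuous_separating (ho : ∀ c, IsOpen (γ.set c)) {a b : C} (hab : C.prec a b) :
    ∃ f : X → unitInterval, Continuous f ∧ Set.EqOn f 0 (γ.set a) ∧ Set.EqOn f 1 (γ.set b)ᶜ := by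
  -- `X` need not be normal, so Urysohn's construction is restricted to pairs separated by some `a ≺
  -- b`; an interpolant `m` gives the intermediate open set `γ.set m`.
  let P : Set X → Set X → Prop := fun c u => ∃ a b, C.prec a b ∧ c ⊆ (γ.set aᶜ)ᶜ ∧ γ.set b ⊆ u
  let F : Urysohns.CU P :=
    { C := closure (γ.set a)
      U := γ.set b
      P_C_U := ⟨a, b, hab, closure_set_subset ho a, subset_rfl⟩
      closed_C := isClosed_closure
      open_U := ho b
      subset := (closure_set_subset ho a).trans (γ.compl_set_compl_subset hab)
      hP := by
        rintro c u - ⟨a, b, hab, hc, hu⟩ - -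
        obtain ⟨m, ham, hmb⟩ := C.prox.interpolate hab
        exact ⟨γ.set m, ho m, hc.trans (γ.compl_set_compl_subset ham),
          ((closure_set_subset ho m).trans (γ.compl_set_compl_subset hmb)).trans hu,
          ⟨a, m, ham, hc, subset_rfl⟩, ⟨m, b, hmb, closure_set_subset ho m, hu⟩⟩ }
  refine ⟨fun x => ⟨F.lim x, F.lim_mem_Icc x⟩, F.continuous_lim.subtype_mk _, fun x hx => ?_,
    fun x hx => ?_⟩
  · exact Subtype.ext (F.lim_of_mem_C x (subset_closure hx))
  · exact Subtype.ext (F.lim_of_notMem_U x hx)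

theorem completelyRegularSpace (hb : IsTopologicalBasis (Set.range γ.set)) :
    CompletelyRegularSpace X := by
  have ho : ∀ c, IsOpen (γ.set c) := fun c => hb.isOpen ⟨c, rfl⟩
  rw [completelyRegularSpace_iff_isOpen]
  intro x K hK hx
  obtain ⟨_, ⟨b, rfl⟩, hxb, hbK⟩ := hb.exists_subset_of_mem_open hx hK
  obtain ⟨a, hab, hxa⟩ := γ.mem_set_iff.mp hxb
  obtain ⟨f, hf, h0, h1⟩ := exists_continuous_separating ho hab
  exact ⟨f, hf, h0 hxa, h1.mono (Set.compl_subset_compl.mpr hbK)⟩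

/-- A basic set inside the exterior of `γ.set a` is disjoint from `γ.set a`; injectivity turns this
into disjointness in `C`, so its index lies below `aᶜ`. -/
theorem set_compl (hγ : Function.Injective γ.toFun) (hb : IsTopologicalBasis (Set.range γ.set))
    (a : C) : γ.set aᶜ = (closure (γ.set a))ᶜ := by
  have ho : ∀ c, IsOpen (γ.set c) := fun c => hb.isOpen ⟨c, rfl⟩
  apply subset_antisymm
  · exact Set.subset_compl_comm.mp (closure_set_subset ho a)
  · intro x hx
    obtain ⟨_, ⟨b, rfl⟩, hxb, hba⟩ :=
      hb.exists_subset_of_mem_open hx isClosed_closure.isOpen_compl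
    refine γ.set_mono ?_ hxb
    rw [le_compl_iff_disjoint_right, ← disjoint_set_iff hγ]
    exact Set.disjoint_left.mpr fun y hy hy' => hba hy (subset_closure hy')

/-- The image of an injective de Vries morphism into a power set consists of the regular open
sets of the topology that it generates. -/
theorem range_eq_regularOpen (hγ : Function.Injective γ.toFun)
    (hb : IsTopologicalBasis (Set.range γ.set)) :
    Set.range γ.set = {U | interior (closure U) = U} := by
  have ho : ∀ c, IsOpen (γ.set c) := fun c => hb.isOpen ⟨c, rfl⟩
  ext U
  constructor
  · rintro ⟨a, rfl⟩
    change interior (closure (γ.set a)) = γ.set a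
    rw [← compl_compl (closure (γ.set a)), ← set_compl hγ hb, interior_compl, ← set_compl hγ hb,
      compl_compl]
  · intro (hU : interior (closure U) = U)
    have hUo : IsOpen U := hU ▸ isOpen_interior
    -- `γ` need not preserve joins, so `γ.set a` is bounded from above through its complement: the
    -- exterior of `U` lies in `γ.set aᶜ`, whence `γ.set a ⊆ cl U`.
    let a : C := sSup {b | γ.set b ⊆ U}
    have hUa : U ⊆ γ.set a := fun x hx => by
      obtain ⟨_, ⟨b, rfl⟩, hxb, hbU⟩ := hb.exists_subset_of_mem_open hx hUo
      exact γ.set_mono (le_sSup hbU) hxb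
    have haU : (closure U)ᶜ ⊆ γ.set aᶜ := fun x hx => by
      obtain ⟨_, ⟨b, rfl⟩, hxb, hbU⟩ :=
        hb.exists_subset_of_mem_open hx isClosed_closure.isOpen_compl
      refine γ.set_mono ?_ hxb
      rw [le_compl_iff_disjoint_right, disjoint_sSup_iff]
      intro c hc
      rw [← disjoint_set_iff hγ]
      exact Set.disjoint_left.mpr fun y hy hy' => hbU hy (subset_closure (hc hy'))
    refine ⟨a, subset_antisymm ?_ hUa⟩
    rw [← hU]
    refine interior_maximal ?_ (ho a)
    have := Set.compl_subset_comm.mp haU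
    exact (γ.set_subset_compl a).trans this

end DeVMor

end PowerSet

/-! ### The de Vries extension of a compactification -/

section PreimageExtension

variable {X Y : Type u} [TopologicalSpace Y] [CompactSpace Y] [T2Space Y]

/-- The de Vries morphism `U ↦ e⁻¹(U)` from regular open sets to the power set. -/
def preimageMor (e : X → Y) : DeVMor (roAlg Y) (powAlg X) where
  toFun U := e ⁻¹' RegOpens.set U
  map_bot := rfl
  map_inf _ _ := rfl
  map_prec U V h := by
    have h1 : (e ⁻¹' RegOpens.set (Y := Y) Uᶜ)ᶜ ⊆ e ⁻¹' RegOpens.set V := by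
      rw [RegOpens.set_compl (Y := Y) U, Set.preimage_compl, compl_compl]
      exact Set.preimage_mono h
    exact h1
  map_eq_sSup U := by
    apply le_antisymm
    · intro x hx
      obtain ⟨V, hV, hVU⟩ := RegOpens.exists_mem_closure_subset (RegOpens.isOpen U) hx
      exact Set.mem_sUnion.mpr ⟨_, ⟨V, hVU, rfl⟩, hV⟩
    · apply sSup_le
      rintro _ ⟨V, hV, rfl⟩
      exact Set.preimage_mono ((roAlg Y).prox.le_of_rel hV)

/-- A regular open set is the interior of the closure of its trace on a dense subset. -/
theorem preimageMor_injective {e : X → Y} (he : DenseRange e) :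
    Function.Injective (preimageMor e).toFun := by
  have key : ∀ U V : RegOpens Y, e ⁻¹' U.set = e ⁻¹' V.set → U.set ⊆ V.set := by
    intro U V h
    rw [← RegOpens.interior_closure_set V]
    refine interior_maximal ?_ U.isOpen
    refine (he.open_subset_closure_inter U.isOpen).trans (closure_mono ?_)
    rintro _ ⟨hU, x, rfl⟩
    exact h.subset hU
  exact fun U V h => RegOpens.set_injective (subset_antisymm (key U V h) (key V U h.symm))

theorem isTopologicalBasis_preimageMor [TopologicalSpace X] {e : X → Y}
    (he : Topology.IsInducing e) : IsTopologicalBasis (Set.range (preimageMor e).set) := by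
  refine isTopologicalBasis_of_isOpen_of_nhds ?_ fun x W hx hW => ?_
  · rintro _ ⟨U, rfl⟩
    exact (RegOpens.isOpen U).preimage he.continuous
  · obtain ⟨W', hW', rfl⟩ := he.isOpen_iff.mp hW
    obtain ⟨U, hxU, hU⟩ := RegOpens.exists_mem_closure_subset hW' hx
    exact ⟨_, ⟨U, rfl⟩, hxU, Set.preimage_mono (subset_closure.trans hU)⟩

/-- In a Hausdorff `Y`, the traces containing `x` intersect in `{x}`, and every set is a union of
singletons. -/
theorem exists_eq_sSup_sInf_preimage {e : X → Y} (hi : Function.Injective e) (b : Set X) :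
    ∃ 𝒮 : Set (Set (Set X)), (∀ S ∈ 𝒮, S ⊆ Set.range (preimageMor e).set) ∧
      b = sSup (sInf '' 𝒮) := by
  have hS : ∀ x, sInf {s | s ∈ Set.range (preimageMor e).set ∧ x ∈ s} = {x} := by
    intro x
    apply subset_antisymm
    · intro y hy
      by_contra hne
      obtain ⟨U, hxU, hU⟩ := RegOpens.exists_mem_closure_subset (y := e x)
        (isOpen_compl_singleton (x := e y)) fun h => hne (hi h.symm)
      have := Set.mem_sInter.mp hy _ ⟨⟨U, rfl⟩, hxU⟩
      exact hU (subset_closure this) rfl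
    · rintro _ rfl
      exact Set.mem_sInter.mpr fun s hs => hs.2
  refine ⟨(fun x => {s | s ∈ Set.range (preimageMor e).set ∧ x ∈ s}) '' b, ?_, ?_⟩
  · rintro _ ⟨x, -, rfl⟩ s hs
    exact hs.1
  rw [Set.image_image, sSup_image]
  simp only [hS]
  exact (Set.biUnion_of_singleton b).symm

theorem isExtension_preimageMor {e : X → Y} (he : DenseRange e) (hi : Function.Injective e) :
    IsExtension (preimageMor e) where
  isAtomicED := powAlg_isAtomicED X
  injective := preimageMor_injective he
  joinMeetDense := exists_eq_sSup_sInf_preimage hi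

end PreimageExtension

/-! ### Stone-Čech compactifications and maximal extensions -/

section StoneCech

/-- The de Vries extension `U ↦ e⁻¹(U)` of a compactification `e`. -/
def Compactification.toDeVExt (c : Compactification.{u}) : DeVExt.{u} where
  A := roAlg c.Y
  B := powAlg c.X
  α := preimageMor c.e
  isExtension := isExtension_preimageMor c.denseRange c.isEmbedding.injective

theorem IsStoneCech.exists_extend {c : Compactification.{u}} (hc : IsStoneCech c) {Z : Type*}
    [TopologicalSpace Z] [CompactSpace Z] [T2Space Z] {f : c.X → Z} (hf : Continuous f) :
    ∃ g : C(c.Y, Z), ∀ x, g (c.e x) = f x := by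
  obtain ⟨h, hh, he⟩ := hc.2
  refine ⟨⟨stoneCechExtend hf ∘ h, (continuous_stoneCechExtend hf).comp hh⟩, fun x => ?_⟩
  change stoneCechExtend hf ((h ∘ c.e) x) = f x
  rw [he, stoneCechExtend_stoneCechUnit]

/-- If `X` is functionally separated between `e⁻¹(U)` and the complement of `e⁻¹(V)`, where `e`
is a Stone-Čech compactification, then `U ≺ V`. -/
theorem IsStoneCech.closure_subset {c : Compactification.{u}} (hc : IsStoneCech c)
    {U V : RegOpens c.Y} {f : c.X → unitInterval} (hf : Continuous f)
    (h0 : Set.EqOn f 0 (c.e ⁻¹' U.set)) (h1 : Set.EqOn f 1 (c.e ⁻¹' V.set)ᶜ) :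
    closure U.set ⊆ V.set := by
  obtain ⟨g, hg⟩ := hc.exists_extend hf
  have hU : closure U.set ⊆ g ⁻¹' {0} := by
    refine closure_minimal ?_ (isClosed_singleton.preimage g.continuous)
    refine (c.denseRange.open_subset_closure_inter U.isOpen).trans
      (closure_minimal ?_ (isClosed_singleton.preimage g.continuous))
    rintro _ ⟨hU, x, rfl⟩
    exact (hg x).trans (h0 hU)
  -- The open set where `g ≠ 1` has its trace on `X` inside that of `V`; density puts it in `cl V`,
  -- and regularity of `V` puts it in `V`.
  have hV : g ⁻¹' {1}ᶜ ⊆ V.set := by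
    have ho : IsOpen (g ⁻¹' {1}ᶜ) := isOpen_compl_singleton.preimage g.continuous
    rw [← RegOpens.interior_closure_set V]
    refine interior_maximal ?_ ho
    refine (c.denseRange.open_subset_closure_inter ho).trans (closure_mono ?_)
    rintro _ ⟨hx, x, rfl⟩
    by_contra hV
    exact hx ((hg x).trans (h1 hV))
  refine hU.trans (subset_trans ?_ hV)
  intro y (hy : g y = 0) (hy' : g y = 1)
  exact zero_ne_one (hy.symm.trans hy')

/-- An order isomorphism between the domains of two injective de Vries morphisms with the same
image. -/
theorem DeVMor.exists_orderIso {A B C : DeVAlg.{u}} {α : DeVMor A B} {γ : DeVMor C B}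
    (hα : Function.Injective α.toFun) (hγ : Function.Injective γ.toFun) (h : Compatible α γ) :
    ∃ θ : C ≃o A, ∀ c, α (θ c) = γ c := by
  let α' : A ↪o B := ⟨⟨α.toFun, hα⟩, α.le_iff_le hα⟩
  let γ' : C ↪o B := ⟨⟨γ.toFun, hγ⟩, γ.le_iff_le hγ⟩
  let θ : C ≃o A :=
    (γ'.orderIso.trans (OrderIso.setCongr (Set.range γ') (Set.range α') h.symm)).trans
      α'.orderIso.symm
  refine ⟨θ, fun c => ?_⟩
  have h1 : α'.orderIso (θ c) = OrderIso.setCongr (Set.range γ') (Set.range α') h.symm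
    (γ'.orderIso c) := α'.orderIso.apply_symm_apply _
  exact congrArg Subtype.val h1

/-- Equal images already give an order isomorphism `θ` over the power set. What remains is that `θ`
preserves the proximity, which follows by extending the separating function of `a ≺ b` to the
compactification. -/
theorem IsStoneCech.isMaximal {c : Compactification.{u}} (hc : IsStoneCech c) :
    IsMaximal c.toDeVExt := by
  intro C γ hγ hcomp
  obtain ⟨θ, hθ⟩ := DeVMor.exists_orderIso c.toDeVExt.isExtension.injective hγ.injective hcomp
  have ho : ∀ a, IsOpen (DeVMor.set (X := c.X) γ a) := by
    intro a
    have : DeVMor.set (X := c.X) γ a = c.e ⁻¹' RegOpens.set (θ a) := (hθ a).symm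
    rw [this]
    exact (RegOpens.isOpen _).preimage c.isEmbedding.continuous
  refine ⟨DeVMor.ofOrderIso θ fun a b hab => ?_, ?_⟩
  · have hθ' : ∀ a, c.e ⁻¹' RegOpens.set (θ a) = DeVMor.set (X := c.X) γ a := hθ
    obtain ⟨f, hf, h0, h1⟩ := DeVMor.exists_continuous_separating ho hab
    refine hc.closure_subset hf (fun x hx => h0 ?_) (fun x hx => h1 ?_)
    · exact (hθ' a).subset hx
    · exact fun h => hx ((hθ' b).symm.subset h)
  · ext b
    refine Eq.trans ?_ (γ.map_eq_sSup b).symm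
    exact congrArg sSup (Set.image_congr fun a _ => hθ a)

/-- The Stone-Čech compactification of a completely regular Hausdorff space. -/
def stoneCechCompactification (X : Type u) [TopologicalSpace X] [T35Space X] :
    Compactification.{u} where
  X := X
  Y := StoneCech X
  e := stoneCechUnit
  isEmbedding := isEmbedding_stoneCechUnit
  denseRange := denseRange_stoneCechUnit

theorem isStoneCech_stoneCechCompactification (X : Type u) [TopologicalSpace X] [T35Space X] :
    IsStoneCech (stoneCechCompactification X) :=
  ⟨⟨id, continuous_id, rfl⟩, ⟨id, continuous_id, rfl⟩⟩

end StoneCech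

/-! ### The functor from compactifications to de Vries extensions -/

section Functor

variable {c c' : Compactification.{u}}

/-- The composition `⋆` undoes the regularization: `V ≺ U` forces `int cl g⁻¹(V) ⊆ g⁻¹(cl V) ⊆
g⁻¹(U)`, and such `V` cover `U`. -/
theorem preimage_preimageMor_eq_star (p : CompactificationHom c c') (U : roAlg c'.Y) :
    p.f ⁻¹' (preimageMor c'.e).set U = ((preimageMor c.e).star (roMap p.g)).set U := by
  ext x
  rw [DeVMor.mem_star_set_iff]
  change c'.e (p.f x) ∈ RegOpens.set U ↔ _
  rw [← p.comm]
  constructor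
  · intro hx
    obtain ⟨V, hxV, hVU⟩ := RegOpens.exists_mem_closure_subset (RegOpens.isOpen U) hx
    exact ⟨V, hVU, RegOpens.preimage_subset_set_comap p.g V hxV⟩
  · rintro ⟨V, hVU, hx⟩
    exact hVU (RegOpens.set_comap_subset p.g V hx)

/-- The morphism of de Vries extensions of a morphism of compactifications. -/
def CompactificationHom.toDeVExtHom (p : CompactificationHom c c') :
    DeVExtHom c'.toDeVExt c.toDeVExt where
  ρ := roMap p.g
  σ := CompleteLatticeHom.setPreimage p.f
  comm := preimage_preimageMor_eq_star p

/-- The contravariant functor `e ↦ e⁻¹` from compactifications to de Vries extensions. -/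
def toDeVExtFunctor : Compactification.{u}ᵒᵖ ⥤ DeVExt.{u} where
  obj c := c.unop.toDeVExt
  map p := CompactificationHom.toDeVExtHom p.unop
  map_id _ := DeVExtHom.ext_of_σ rfl
  map_comp _ _ := DeVExtHom.ext_of_σ rfl

theorem CompactificationHom.ext_of_f {p q : CompactificationHom c c'} (h : p.f = q.f) : p = q := by
  refine CompactificationHom.ext h (ContinuousMap.ext fun y => ?_)
  refine congrFun (c.denseRange.equalizer p.g.continuous q.g.continuous (funext fun x => ?_)) y
  change p.g (c.e x) = q.g (c.e x)
  rw [p.comm, q.comm, h]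

instance : toDeVExtFunctor.{u}.Faithful where
  map_injective {c c' p q} h := by
    refine Quiver.Hom.unop_inj (CompactificationHom.ext_of_f (ContinuousMap.ext fun x => ?_))
    have h1 : (CompactificationHom.toDeVExtHom p.unop).σ =
      (CompactificationHom.toDeVExtHom q.unop).σ := congrArg DeVExtHom.σ h
    -- Evaluating both preimage maps at the singleton of `p.unop.f x` recovers the value at `x`.
    have h2 : (p.unop.f ⁻¹' {p.unop.f x} : Set c'.unop.X) = q.unop.f ⁻¹' {p.unop.f x} :=
      DFunLike.congr_fun h1 ({p.unop.f x} : Set c.unop.X)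
    exact (h2.subset (Set.mem_singleton (p.unop.f x))).symm

/-- A complete Boolean homomorphism between power sets is the preimage map of a function. -/
theorem exists_eq_preimage {X X' : Type u} (σ : CompleteLatticeHom (Set X') (Set X)) :
    ∃ f : X → X', ∀ S, σ S = f ⁻¹' S := by
  -- The singletons join to the top element, so `x` lies in `σ {x'}` for some `x'`; this `x'` is
  -- taken as the value at `x`.
  have hex : ∀ x, ∃ x', x ∈ σ {x'} := by
    intro x
    have h : σ (sSup (Set.range fun x' : X' => {x'})) = Set.univ := by
      have : sSup (Set.range fun x' : X' => ({x'} : Set X')) = ⊤ := by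
        rw [sSup_range]
        exact Set.iUnion_of_singleton X'
      rw [this]
      exact map_top σ
    rw [map_sSup] at h
    have hx : x ∈ sSup (σ '' Set.range fun x' : X' => ({x'} : Set X')) := h ▸ Set.mem_univ x
    obtain ⟨_, ⟨_, ⟨x', rfl⟩, rfl⟩, hx'⟩ := Set.mem_sUnion.mp hx
    exact ⟨x', hx'⟩
  choose f hf using hex
  refine ⟨f, fun S => ?_⟩
  ext x
  constructor
  · intro hx
    by_contra hn
    have : x ∈ σ (S ⊓ {f x}) := by
      rw [map_inf]
      exact ⟨hx, hf x⟩
    rw [show S ⊓ {f x} = ⊥ from Set.inter_singleton_eq_empty.mpr hn, map_bot] at this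
    exact this
  · intro hx
    have hle : σ {f x} ⊆ σ S := OrderHomClass.mono σ (Set.singleton_subset_iff.mpr hx)
    exact hle (hf x)

/-- The commuting square writes the preimage of a basic open set as a union of open sets, so the
function inducing `σ` is continuous. Only the source compactification has to be Stone–Čech, in order
to extend it. -/
theorem IsStoneCech.toDeVExtHom_surjective (hc : IsStoneCech c)
    (m : DeVExtHom c'.toDeVExt c.toDeVExt) :
    ∃ p : CompactificationHom c c', p.toDeVExtHom = m := by
  obtain ⟨f, hf⟩ := exists_eq_preimage (X := c.X) (X' := c'.X) m.σ
  have hcont : Continuous f := by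
    refine (isTopologicalBasis_preimageMor c'.isEmbedding.isInducing).continuous_iff.mpr ?_
    rintro _ ⟨U, rfl⟩
    have h : f ⁻¹' (preimageMor c'.e).set U = ((preimageMor c.e).star m.ρ).set U :=
      (hf _).symm.trans (m.comm U)
    rw [h, isOpen_iff_mem_nhds]
    intro x hx
    obtain ⟨V, hV, hx⟩ := (DeVMor.mem_star_set_iff _ _).mp hx
    refine Filter.mem_of_superset
      (((RegOpens.isOpen _).preimage c.isEmbedding.continuous).mem_nhds hx) fun y hy => ?_
    exact (DeVMor.mem_star_set_iff _ _).mpr ⟨V, hV, hy⟩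
  obtain ⟨g, hg⟩ := hc.exists_extend (c'.isEmbedding.continuous.comp hcont)
  refine ⟨⟨⟨f, hcont⟩, g, hg⟩, DeVExtHom.ext_of_σ ?_⟩
  exact DFunLike.ext _ _ fun S => (hf S).symm

end Functor

/-! ### The space of atoms of a de Vries extension -/

section Atoms

variable (E : DeVExt.{u})

/-- The atoms of the codomain of a de Vries extension. -/
def DeVExt.Atoms : Type u := {b : E.B // IsAtom b}

/-- The representation of the codomain of a de Vries extension as a power set. -/
def DeVExt.orderIso : E.B ≃o powAlg E.Atoms :=
  letI := E.isExtension.isAtomicED.isAtomic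
  letI : CompleteAtomicBooleanAlgebra E.B :=
    CompleteBooleanAlgebra.toCompleteAtomicBooleanAlgebra
  CompleteAtomicBooleanAlgebra.toSetOfIsAtom

/-- A de Vries extension with its codomain represented as a power set. -/
def DeVExt.powMor : DeVMor E.A (powAlg E.Atoms) :=
  E.α.postcomp E.isExtension.isAtomicED.prec_iff_le (powAlg_isAtomicED _).prec_iff_le E.orderIso

theorem DeVExt.isExtension_powMor : IsExtension E.powMor :=
  E.isExtension.postcomp (powAlg_isAtomicED _) E.orderIso

theorem DeVMor.isTopologicalBasis_generateFrom {X : Type u} {C : DeVAlg.{u}}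
    (γ : DeVMor C (powAlg X)) :
    @IsTopologicalBasis X (generateFrom (Set.range γ.set)) (Set.range γ.set) := by
  let := generateFrom (Set.range γ.set)
  refine ⟨?_, ?_, rfl⟩
  · rintro _ ⟨a, rfl⟩ _ ⟨b, rfl⟩ x hx
    exact ⟨_, ⟨a ⊓ b, rfl⟩, (γ.set_inf a b).symm ▸ hx, (γ.set_inf a b).subset⟩
  · exact Set.eq_univ_of_univ_subset (Set.subset_sUnion_of_mem ⟨⊤, γ.map_top⟩)

/-- The topology generated by an extension into a power set is Hausdorff and completely regular. -/
theorem IsExtension.t35Space {X : Type u} {C : DeVAlg.{u}} {γ : DeVMor C (powAlg X)}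
    (hγ : IsExtension γ) : @T35Space X (generateFrom (Set.range γ.set)) := by
  let := generateFrom (Set.range γ.set)
  have hb := γ.isTopologicalBasis_generateFrom
  have := DeVMor.completelyRegularSpace hb
  have : T0Space X := by
    refine ⟨fun x y hxy => ?_⟩
    -- Some meet of basic open sets contains `x` and lies in `{x}`; a point inseparable from `x`
    -- belongs to the same basic sets, hence to this meet.
    obtain ⟨𝒮, h𝒮, hx⟩ : ∃ 𝒮 : Set (Set (Set X)), (∀ S ∈ 𝒮, S ⊆ Set.range γ.set) ∧
      {x} = sSup (sInf '' 𝒮) := hγ.joinMeetDense ({x} : Set X)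
    obtain ⟨_, ⟨S, hS, rfl⟩, hxS⟩ := Set.mem_sUnion.mp (hx.subset (Set.mem_singleton x))
    have hyS : y ∈ sInf S := Set.mem_sInter.mpr fun s hs =>
      (hxy.mem_open_iff (hb.isOpen (h𝒮 S hS hs))).mp (Set.mem_sInter.mp hxS s hs)
    exact (hx.symm.subset (Set.mem_sUnion.mpr ⟨_, ⟨S, hS, rfl⟩, hyS⟩) : y = x).symm
  exact {}

instance : TopologicalSpace E.Atoms := generateFrom (Set.range E.powMor.set)

instance : T35Space E.Atoms := E.isExtension_powMor.t35Space

/-- The Stone-Čech compactification of the space of atoms of a de Vries extension. -/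
def DeVExt.stoneCech : Compactification.{u} := stoneCechCompactification E.Atoms

/-- Both images are the family of all regular open subsets of the space of atoms. -/
theorem DeVExt.compatible_powMor : Compatible E.stoneCech.toDeVExt.α E.powMor :=
  (DeVMor.range_eq_regularOpen E.stoneCech.toDeVExt.isExtension.injective
    (isTopologicalBasis_preimageMor E.stoneCech.isEmbedding.isInducing)).trans
    (DeVMor.range_eq_regularOpen E.isExtension_powMor.injective
      E.powMor.isTopologicalBasis_generateFrom).symm

/-- An order isomorphism as a complete lattice homomorphism. -/
def completeLatticeHomOfOrderIso {A B : Type*} [CompleteLattice A] [CompleteLattice B]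
    (θ : A ≃o B) : CompleteLatticeHom A B where
  toFun := θ
  map_sInf' s := by rw [θ.map_sInf, sInf_image]
  map_sSup' s := by rw [θ.map_sSup, sSup_image]

variable {E}

/-- The maximality of `E` enters here: the Stone–Čech extension, carried back to the codomain `E.B`,
has the same image as `E.α` and so factors through it. -/
theorem IsMaximal.exists_hom (hE : IsMaximal E) :
    ∃ m : DeVExtHom E.stoneCech.toDeVExt E,
      m.σ = completeLatticeHomOfOrderIso E.orderIso.symm := by
  have hγ := E.stoneCech.toDeVExt.isExtension.postcomp E.isExtension.isAtomicED E.orderIso.symm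
  obtain ⟨δ, hδ⟩ := hE _ _ hγ (by
    have h := congrArg (fun S => E.orderIso.symm '' S) E.compatible_powMor
    refine Eq.trans ?_ (((Set.range_comp _ _).trans h).trans (Set.range_comp _ _).symm).symm
    exact congrArg Set.range (funext fun a => (E.orderIso.symm_apply_apply (E.α a)).symm))
  exact ⟨⟨δ, _, fun a => (congrArg (fun μ : DeVMor _ _ => μ a) hδ).symm⟩, rfl⟩

/-- This direction holds for every extension, since it rests on the maximality of the Stone–Čech
extension instead. -/
theorem DeVExt.exists_hom_stoneCech (E : DeVExt.{u}) :
    ∃ m : DeVExtHom E E.stoneCech.toDeVExt, m.σ = completeLatticeHomOfOrderIso E.orderIso := by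
  obtain ⟨δ, hδ⟩ := (isStoneCech_stoneCechCompactification E.Atoms).isMaximal _ _
    E.isExtension_powMor E.compatible_powMor
  exact ⟨⟨δ, completeLatticeHomOfOrderIso E.orderIso,
    fun a => (congrArg (fun μ : DeVMor _ _ => μ a) hδ).symm⟩, rfl⟩

/-- A maximal de Vries extension is isomorphic to the extension of the Stone-Čech compactification
of its space of atoms. -/
theorem IsMaximal.nonempty_iso (hE : IsMaximal E) : Nonempty (E.stoneCech.toDeVExt ≅ E) := by
  obtain ⟨m, hm⟩ := hE.exists_hom
  obtain ⟨n, hn⟩ := E.exists_hom_stoneCech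
  refine ⟨⟨m, n, DeVExtHom.ext_of_σ (DFunLike.ext _ _ fun b => ?_),
    DeVExtHom.ext_of_σ (DFunLike.ext _ _ fun b => ?_)⟩⟩
  · change n.σ (m.σ b) = b
    rw [hm, hn]
    exact E.orderIso.apply_symm_apply b
  · change m.σ (n.σ b) = b
    rw [hm, hn]
    exact E.orderIso.symm_apply_apply b

end Atoms

/-! ### The dual equivalence -/

/-- The contravariant functor `e ↦ e⁻¹` from Stone-Čech compactifications to maximal de Vries
extensions. -/
def scToMDeVe : SC.{u}ᵒᵖ ⥤ MDeVe.{u} :=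
  IsMaximal.lift (IsStoneCech.ι.op ⋙ toDeVExtFunctor) fun c => c.unop.property.isMaximal

instance : (IsStoneCech.ι.op ⋙ toDeVExtFunctor.{u}).Full where
  map_surjective {c c'} m := by
    obtain ⟨p, hp⟩ := c'.unop.property.toDeVExtHom_surjective (c' := c.unop.obj) m
    exact ⟨Quiver.Hom.op (ObjectProperty.homMk p), hp⟩

instance : scToMDeVe.{u}.Full :=
  have : (IsStoneCech.{u}.ι.op ⋙ toDeVExtFunctor.{u}).Full := inferInstance
  Functor.Full.of_comp_faithful_iso (IsMaximal.liftCompιIso (IsStoneCech.ι.op ⋙ toDeVExtFunctor) _)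

instance : scToMDeVe.{u}.Faithful :=
  have : (IsStoneCech.{u}.ι.op ⋙ toDeVExtFunctor.{u}).Faithful := inferInstance
  Functor.Faithful.of_comp_iso (IsMaximal.liftCompιIso (IsStoneCech.ι.op ⋙ toDeVExtFunctor) _)

instance : scToMDeVe.{u}.EssSurj where
  mem_essImage E := by
    obtain ⟨i⟩ := E.property.nonempty_iso
    exact ⟨Opposite.op ⟨E.obj.stoneCech, isStoneCech_stoneCechCompactification _⟩,
      ⟨IsMaximal.isoMk i⟩⟩

instance : scToMDeVe.{u}.IsEquivalence where

end DeVries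

theorem theorem6p5 : Nonempty (DeVries.MDeVe.{u}ᵒᵖ ≌ DeVries.SC.{u}) := by
  exact ⟨DeVries.scToMDeVe.asEquivalence.op.symm.trans (opOpEquivalence _)⟩
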